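/- A Salem number is a real algebraic integer $\beta>1$ such that every conjugate $\alpha\neq\beta$ of $\beta$ over $\mathbb{Q}$ satisfies $|\alpha|\le 1$ and at least one conjugate satisfies $|\alpha|=1$. For a finite-dimensional real vector space $V$, the real-valued generalised polynomial maps on $V$ form the smallest class of functions $V\to\mathbb{R}$ that contains the constants and the linear functionals and is closed under addition, multiplication and $f\mapsto\lfloor f\rfloor$; a map $V\to\mathbb{C}$ is a generalised polynomial map if its real and imaginary parts are. A map $f\colon K\to\mathbb{C}$ on a number field $K$ is a generalised polynomial map if $f=F\circ\iota$ for some generalised polynomial map $F\colon K\otimes_{\mathbb{Q}}\mathbb{R}\to\mathbb{C}$, where $\iota(x)=x\otimes 1$; a subset $S\subset K$ is generalised polynomial if its characteristic function $1_S$ is a generalised polynomial map on $K$. Theorem. Let $\beta$ be a Salem number and let $(n_i)_{i\ge 0}$ be a sequence of rational numbers satisfying a linear recurrence $n_{i+m}=\sum_{j=0}^{m-1}a_jn_{i+j}$ $(i\ge 0)$ with $a_j\in\mathbb{Q}$, whose characteristic polynomial $X^m-\sum_{j=0}^{m-1}a_jX^j$ is the minimal polynomial of $\beta$ over $\mathbb{Q}$.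 Then the set $\{n_i : i\ge 0\}$ is a generalised polynomial subset of $\mathbb{Q}$. -/

import Mathlib

open scoped TensorProduct

namespace GenPoly

/-- Real-valued generalised polynomial maps on a (finite-dimensional) real vector space `V`: the
smallest class of functions `V → ℝ` containing the constant maps and the linear functionals, and
closed under addition, multiplication and taking integer parts. -/
inductive IsRealGenPoly {V : Type*} [AddCommGroup V] [Module ℝ V] : (V → ℝ) → Prop
  | const (c : ℝ) : IsRealGenPoly (fun _ => c)
  | linear (φ : V →ₗ[ℝ] ℝ) : IsRealGenPoly (fun v => φ v)
  | add {f g : V → ℝ} : IsRealGenPoly f → IsRealGenPoly g → IsRealGenPoly (fun v => f v + g v)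
  | mul {f g : V → ℝ} : IsRealGenPoly f → IsRealGenPoly g → IsRealGenPoly (fun v => f v * g v)
  | floor {f : V → ℝ} : IsRealGenPoly f → IsRealGenPoly (fun v => (⌊f v⌋ : ℝ))

/-- Complex-valued generalised polynomial maps on a real vector space: the real and the imaginary
part are real-valued generalised polynomial maps. -/
def IsComplexGenPoly {V : Type*} [AddCommGroup V] [Module ℝ V] (f : V → ℂ) : Prop :=
  IsRealGenPoly (fun v => (f v).re) ∧ IsRealGenPoly (fun v => (f v).im)

/-- A map `f : K → ℂ` on a number field `K` is a generalised polynomial map if `f = F ∘ ι` for some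
generalised polynomial map `F` on the real vector space `ℝ ⊗[ℚ] K`, where `ι x = 1 ⊗ x`. -/
def IsGenPolyMap {K : Type*} [Field K] [NumberField K] (f : K → ℂ) : Prop :=
  ∃ F : ℝ ⊗[ℚ] K → ℂ, IsComplexGenPoly F ∧ ∀ x : K, f x = F ((1 : ℝ) ⊗ₜ[ℚ] x)

/-- A subset of a number field is generalised polynomial if its characteristic function is a
generalised polynomial map. -/
def IsGenPolySet {K : Type*} [Field K] [NumberField K] (S : Set K) : Prop :=
  IsGenPolyMap (S.indicator (fun _ => (1 : ℂ)))

/-- `α` is a (Galois) conjugate over `ℚ` of the (algebraic) real number `β`. -/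
def IsConjugate (α : ℂ) (β : ℝ) : Prop :=
  Polynomial.aeval α (minpoly ℚ β) = 0

/-- Salem numbers: real algebraic integers `β > 1` all of whose other conjugates lie in the closed
unit disc, at least one of them lying on the unit circle. -/
def IsSalem (β : ℝ) : Prop :=
  IsIntegral ℤ β ∧ 1 < β ∧
    (∀ α : ℂ, IsConjugate α β → α ≠ (β : ℂ) → ‖α‖ ≤ 1) ∧
    ∃ α : ℂ, IsConjugate α β ∧ ‖α‖ = 1

end GenPoly

/-! Write `K = ℚ(β)`. The number `β` has the real conjugate `β⁻¹`, and all its other conjugates lie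
on the unit circle, because conjugation on the unit circle is inversion
(`IsSalem.exists_isSalemUnit_gen`). Let `ι`, `τ` be the real embeddings of `K` with `ι β = β` and
`τ β = β⁻¹`.

*Powers of `β` in `K`.* The algebraic integers `x` with `ι x * τ x = 1`, `0 < τ x ≤ 1` and
`|φ x| = 1` for the remaining complex embeddings `φ` are products `u * β ^ m` with `u` in a finite
set of units with `1 ≤ u < β`, and a common power satisfies `u ^ k = β ^ l` with `l < k`. To single
out `u = 1`, take `w = β ^ M ≡ 1` modulo `k` and demand that `x` be congruent to a power of `β`
modulo `w ^ k - 1`. This forces `w ^ k - 1 ∣ w ^ l - 1`; after division by `w - 1`, and modulo `k`,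
it gives `k ∣ l`, so `l = 0` and `u = 1` (`IsSalemUnit.exists_forall_eq_pow_iff`). All these
conditions are integrality of linear forms or vanishing of generalised polynomials, and both can be
tested by generalised polynomials: a real `y` is zero exactly when `y` and `√2 * y` are integers.

*From `K` to `ℚ`.* The recurrence says `n i = μ (β ^ i)` for a linear functional `μ` on `K`. Every
such functional is a trace `Tr (c * ·)`, hence equals `c * β ^ i + O(1)` on the powers of `β`, with
`c ≠ 0` for `μ ≠ 0`. So the integer coordinates of `β ^ i` in an integral basis are `⌊κ * n i⌋` up to
an error from a finite set of integers: `β ^ i` is one of finitely many generalised polynomial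
expressions in `n i`, and a rational `q` is a value of the sequence exactly when one of them, at `q`,
is a power of `β` on which `μ` takes the value `q` (`IsSalemUnit.isRealGenPolySet_range`). -/

/-! ### Calculus of generalised polynomial maps and sets -/

namespace GenPoly

section Calculus

variable {L : Type*} [Field L] [NumberField L]

/-- A real-valued function on a number field `L` is a generalised polynomial map if it is the
restriction to `L` of a real generalised polynomial map on `ℝ ⊗[ℚ] L`. -/
def IsRealGenPolyMap (f : L → ℝ) : Prop :=
  ∃ F : ℝ ⊗[ℚ] L → ℝ, IsRealGenPoly F ∧ ∀ x : L, f x = F ((1 : ℝ) ⊗ₜ[ℚ] x)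

namespace IsRealGenPolyMap

lemma const (c : ℝ) : IsRealGenPolyMap (fun _ : L => c) :=
  ⟨_, IsRealGenPoly.const c, fun _ => rfl⟩

lemma linear (φ : L →ₗ[ℚ] ℝ) : IsRealGenPolyMap (fun x : L => φ x) :=
  ⟨_, IsRealGenPoly.linear (LinearMap.liftBaseChange ℝ φ), fun x => by simp⟩

lemma add {f g : L → ℝ} (hf : IsRealGenPolyMap f) (hg : IsRealGenPolyMap g) :
    IsRealGenPolyMap (fun x => f x + g x) := by
  obtain ⟨F, hF, hfF⟩ := hf
  obtain ⟨G, hG, hgG⟩ := hg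
  exact ⟨_, hF.add hG, fun x => by simp only [hfF, hgG]⟩

lemma mul {f g : L → ℝ} (hf : IsRealGenPolyMap f) (hg : IsRealGenPolyMap g) :
    IsRealGenPolyMap (fun x => f x * g x) := by
  obtain ⟨F, hF, hfF⟩ := hf
  obtain ⟨G, hG, hgG⟩ := hg
  exact ⟨_, hF.mul hG, fun x => by simp only [hfF, hgG]⟩

lemma floor {f : L → ℝ} (hf : IsRealGenPolyMap f) :
    IsRealGenPolyMap (fun x => (⌊f x⌋ : ℝ)) := by
  obtain ⟨F, hF, hfF⟩ := hf
  exact ⟨_, hF.floor, fun x => by simp only [hfF]⟩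

lemma sub {f g : L → ℝ} (hf : IsRealGenPolyMap f) (hg : IsRealGenPolyMap g) :
    IsRealGenPolyMap (fun x => f x - g x) := by
  have := hf.add ((const (-1)).mul hg)
  simpa [sub_eq_add_neg] using this

lemma fract {f : L → ℝ} (hf : IsRealGenPolyMap f) :
    IsRealGenPolyMap (fun x => Int.fract (f x)) :=
  hf.sub hf.floor

lemma sum {ι : Type*} (s : Finset ι) {f : ι → L → ℝ}
    (hf : ∀ i ∈ s, IsRealGenPolyMap (f i)) :
    IsRealGenPolyMap (fun x => ∑ i ∈ s, f i x) := by
  classical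
  induction s using Finset.induction_on with
  | empty => simpa using const 0
  | insert a s ha ih =>
    simp only [Finset.sum_insert ha]
    exact (hf a (by simp)).add (ih fun i hi => hf i (by simp [hi]))

end IsRealGenPolyMap

/-- A set is generalised polynomial if its real-valued characteristic function is. -/
def IsRealGenPolySet (S : Set L) : Prop :=
  IsRealGenPolyMap (S.indicator (fun _ => (1 : ℝ)))

namespace IsRealGenPolySet

lemma isGenPolySet {S : Set L} (hS : IsRealGenPolySet S) : IsGenPolySet S := by
  obtain ⟨F, hF, h⟩ := hS
  refine ⟨fun v => (F v : ℂ), ⟨by simpa using hF, by simpa using IsRealGenPoly.const 0⟩,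
    fun x => ?_⟩
  simp only [← h]
  by_cases hx : x ∈ S <;> simp [hx]

lemma inter {S T : Set L} (hS : IsRealGenPolySet S) (hT : IsRealGenPolySet T) :
    IsRealGenPolySet (S ∩ T) := by
  have := IsRealGenPolyMap.mul hS hT
  unfold IsRealGenPolySet
  convert this using 2 with x
  by_cases h1 : x ∈ S <;> by_cases h2 : x ∈ T <;> simp [h1, h2]

lemma compl {S : Set L} (hS : IsRealGenPolySet S) : IsRealGenPolySet Sᶜ := by
  have := (IsRealGenPolyMap.const 1).sub hS
  unfold IsRealGenPolySet
  convert this using 2 with x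
  by_cases h1 : x ∈ S <;> simp [h1]

lemma univ : IsRealGenPolySet (Set.univ : Set L) := by
  simpa [IsRealGenPolySet] using IsRealGenPolyMap.const (L := L) 1

lemma forall_mem {ι : Type*} (s : Finset ι) {p : ι → L → Prop}
    (h : ∀ i ∈ s, IsRealGenPolySet {x | p i x}) :
    IsRealGenPolySet {x | ∀ i ∈ s, p i x} := by
  classical
  induction s using Finset.induction_on with
  | empty => simpa using univ
  | insert a s ha ih =>
    simp only [Finset.forall_mem_insert, Set.ofPred_and]
    exact (h a (by simp)).inter (ih fun i hi => h i (by simp [hi]))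

lemma exists_mem {ι : Type*} (s : Finset ι) {p : ι → L → Prop}
    (h : ∀ i ∈ s, IsRealGenPolySet {x | p i x}) :
    IsRealGenPolySet {x | ∃ i ∈ s, p i x} := by
  have := (forall_mem s (p := fun i x => ¬ p i x) fun i hi => (h i hi).compl).compl
  convert this using 1
  ext x
  simp

end IsRealGenPolySet

namespace IsRealGenPolyMap

/-- The indicator of `f ∈ ℤ` is `⌊1 - fract f⌋`. -/
lemma isRealGenPolySet_fract_eq_zero {f : L → ℝ} (hf : IsRealGenPolyMap f) :
    IsRealGenPolySet {x | Int.fract (f x) = 0} := by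
  have := ((const 1).sub hf.fract).floor
  unfold IsRealGenPolySet
  convert this using 2 with x
  have h0 := Int.fract_nonneg (f x)
  have h1 := Int.fract_lt_one (f x)
  by_cases h : Int.fract (f x) = 0
  · simp [h]
  · have : ⌊1 - Int.fract (f x)⌋ = 0 := by
      rw [Int.floor_eq_zero_iff]
      exact ⟨by linarith, by linarith [lt_of_le_of_ne h0 (Ne.symm h)]⟩
    simp [h, this]

/-- A real number `y` vanishes if and only if `y` and `√2 * y` are both integers, so that vanishing
can be tested by fractional parts even where `f` is unbounded. -/
lemma isRealGenPolySet_eq_zero {f : L → ℝ} (hf : IsRealGenPolyMap f) :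
    IsRealGenPolySet {x | f x = 0} := by
  have := hf.isRealGenPolySet_fract_eq_zero.inter
    ((const (√2)).mul hf).isRealGenPolySet_fract_eq_zero
  convert this using 1
  ext x
  simp only [Set.mem_ofPred_eq, Set.mem_inter_iff]
  refine ⟨fun h => by simp [h], fun ⟨h1, h2⟩ => ?_⟩
  rw [Int.fract_eq_zero_iff] at h1 h2
  obtain ⟨a, ha⟩ := h1
  obtain ⟨c, hc⟩ := h2
  by_contra h
  refine irrational_sqrt_two ⟨(c : ℚ) / a, ?_⟩
  push_cast
  rw [ha, hc, mul_div_assoc, div_self h, mul_one]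

lemma isRealGenPolySet_eq {f g : L → ℝ} (hf : IsRealGenPolyMap f) (hg : IsRealGenPolyMap g) :
    IsRealGenPolySet {x | f x = g x} := by
  simpa [sub_eq_zero] using (hf.sub hg).isRealGenPolySet_eq_zero

end IsRealGenPolyMap

lemma isIntegral_iff_forall_repr_integralBasis {K : Type*} [Field K] [NumberField K] {x : K} :
    IsIntegral ℤ x ↔ ∀ i, ∃ z : ℤ, (z : ℚ) = (NumberField.integralBasis K).repr x i := by
  have h : IsIntegral ℤ x ↔ x ∈ Submodule.span ℤ (Set.range (NumberField.integralBasis K)) := by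
    rw [NumberField.mem_span_integralBasis]
    exact ⟨fun h => ⟨⟨x, h⟩, rfl⟩, fun ⟨y, hy⟩ => hy ▸ y.isIntegral_coe⟩
  rw [h, Module.Basis.mem_span_iff_repr_mem]
  simp [Set.mem_range]

/-- A map `X : L → K` between number fields is a generalised polynomial map if all its coordinates
are; for this it is asked that every `ℚ`-linear functional `K → ℝ` composed with `X` is. -/
def IsGenPolyFieldMap {K : Type*} [Field K] [NumberField K] (X : L → K) : Prop :=
  ∀ l : K →ₗ[ℚ] ℝ, IsRealGenPolyMap (fun q => l (X q))

namespace IsGenPolyFieldMap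

variable {K : Type*} [Field K] [NumberField K] {X : L → K}

lemma sub_mul_const (hX : IsGenPolyFieldMap X) (a c : K) :
    IsGenPolyFieldMap (fun q => (X q - a) * c) := by
  intro l
  have := (hX (l.comp (LinearMap.mulRight ℚ c))).sub (.const (l (a * c)))
  simpa [sub_mul] using this

lemma isRealGenPolySet_isIntegral (hX : IsGenPolyFieldMap X) :
    IsRealGenPolySet {q | IsIntegral ℤ (X q)} := by
  have key := IsRealGenPolySet.forall_mem Finset.univ
    (p := fun i q => Int.fract (((NumberField.integralBasis K).repr (X q) i : ℚ) : ℝ) = 0)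
    fun i _ => (hX ((Algebra.linearMap ℚ ℝ).comp
      ((NumberField.integralBasis K).coord i))).isRealGenPolySet_fract_eq_zero
  convert key using 1
  ext q
  simp only [Set.mem_ofPred_eq, isIntegral_iff_forall_repr_integralBasis, Finset.mem_univ,
    true_imp_iff, Int.fract_eq_zero_iff]
  exact forall_congr' fun i => exists_congr fun z =>
    ⟨fun h => by rw [← h]; simp, fun h => by exact_mod_cast h⟩

end IsGenPolyFieldMap

end Calculus

/-! ### Powers of a Salem number among the units of its field -/

open scoped NumberField

section PowerDivisibility

variable {R : Type*} [CommRing R]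

lemma dvd_geom_sum_sub_natCast {a w : R} (h : a ∣ w - 1) (n : ℕ) :
    a ∣ ∑ i ∈ Finset.range n, w ^ i - n := by
  have : ∑ i ∈ Finset.range n, w ^ i - n = ∑ i ∈ Finset.range n, (w ^ i - 1) := by simp
  rw [this]
  refine Finset.dvd_sum fun i _ => h.trans ?_
  simpa using sub_dvd_pow_sub_pow w 1 i

/-- If `w ≡ 1` modulo `k`, then `w ^ k - 1` divides `w ^ l - 1` only if `k` divides `l`: the
quotients of both by `w - 1` are geometric sums, congruent to `k` and to `l` modulo `k`. -/
lemma natCast_dvd_natCast_of_pow_sub_one_dvd [IsDomain R] {w : R} {k l : ℕ} (hw : w ≠ 1)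
    (hk : (k : R) ∣ w - 1) (h : w ^ k - 1 ∣ w ^ l - 1) : (k : R) ∣ (l : R) := by
  rw [← geom_sum_mul, ← geom_sum_mul, mul_dvd_mul_iff_right (sub_ne_zero.2 hw)] at h
  have h1 : (k : R) ∣ ∑ i ∈ Finset.range k, w ^ i := by
    simpa using dvd_add (dvd_geom_sum_sub_natCast hk k) (dvd_refl (k : R))
  have h2 := dvd_sub (h1.trans h) (dvd_geom_sum_sub_natCast hk l)
  simpa using h2

end PowerDivisibility

variable {K : Type*} [Field K]

lemma dvd_of_natCast_dvd_ringOfIntegers [NumberField K] {k l : ℕ} (hk : k ≠ 0)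
    (h : (k : 𝓞 K) ∣ (l : 𝓞 K)) : k ∣ l := by
  obtain ⟨c, hc⟩ := h
  have hkK : (k : K) ≠ 0 := by exact_mod_cast hk
  have h1 : (c : K) = algebraMap ℚ K ((l : ℚ) / k) := by
    have := congrArg (algebraMap (𝓞 K) K) hc
    simp only [map_natCast, map_mul] at this
    rw [map_div₀, map_natCast, map_natCast, eq_div_iff hkK, this, mul_comm]
  have h2 : IsIntegral ℤ ((l : ℚ) / k) := by
    rw [← isIntegral_algebraMap_iff (algebraMap ℚ K).injective, ← h1]
    exact c.isIntegral_coe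
  obtain ⟨z, hz⟩ := IsIntegrallyClosed.isIntegral_iff.1 h2
  have hkQ : (k : ℚ) ≠ 0 := by exact_mod_cast hk
  rw [eq_div_iff hkQ] at hz
  have : (k : ℤ) ∣ (l : ℤ) := ⟨z, by
    have h3 : (z : ℚ) * k = l := hz
    rw [mul_comm]
    exact_mod_cast h3.symm⟩
  exact_mod_cast this

/-- A unit of the ring of integers has finite order modulo every nonzero `k`. -/
lemma exists_natCast_dvd_pow_sub_one [NumberField K] {v : 𝓞 K} (hv : IsUnit v) {k : ℕ}
    (hk : k ≠ 0) :
    ∃ M, 0 < M ∧ (k : 𝓞 K) ∣ v ^ M - 1 := by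
  obtain ⟨v, rfl⟩ := hv
  have hI : Ideal.span {(k : 𝓞 K)} ≠ ⊥ := by
    rw [Ne, Ideal.span_singleton_eq_bot]
    exact_mod_cast hk
  have := Ideal.finiteQuotientOfFreeOfNeBot _ hI
  obtain ⟨M, hM, h⟩ := isOfFinOrder_iff_pow_eq_one.1 (isOfFinOrder_of_finite
    (Units.map (Ideal.Quotient.mk (Ideal.span {(k : 𝓞 K)})).toMonoidHom v))
  refine ⟨M, hM, ?_⟩
  rw [← Ideal.mem_span_singleton, ← Ideal.Quotient.eq_zero_iff_mem]
  have := congrArg Units.val h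
  simp only [Units.val_pow_eq_pow_val, Units.coe_map, Units.val_one] at this
  rw [map_sub, map_pow, map_one, sub_eq_zero]
  exact this

/-- The algebraic integers `x` of `K` with `ι x = (τ x)⁻¹ > 0`, all of whose images under the
complex embeddings other than those induced by `ι` and `τ` lie on the unit circle. For a Salem
number in `K = ℚ(β)`, with `τ β = β⁻¹`, they form a group of units that contains the powers of `β`
as a subgroup of finite index. -/
structure IsSalemUnit (ι τ : K →+* ℝ) (x : K) : Prop where
  isIntegral : IsIntegral ℤ x
  mul_eq_one : ι x * τ x = 1
  pos : 0 < τ x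
  norm_eq_one : ∀ φ : K →+* ℂ, φ ≠ Complex.ofRealHom.comp ι → φ ≠ Complex.ofRealHom.comp τ →
    ‖φ x‖ = 1

namespace IsSalemUnit

variable {ι τ : K →+* ℝ} {x y b : K}

lemma ι_pos (hx : IsSalemUnit ι τ x) : 0 < ι x :=
  pos_of_mul_pos_left (by rw [hx.mul_eq_one]; exact one_pos) hx.pos.le

lemma ne_zero (hx : IsSalemUnit ι τ x) : x ≠ 0 := by
  rintro rfl
  simpa using hx.pos

lemma map_eq_inv (hx : IsSalemUnit ι τ x) : τ x = (ι x)⁻¹ :=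
  eq_inv_of_mul_eq_one_right hx.mul_eq_one

lemma one (ι τ : K →+* ℝ) : IsSalemUnit ι τ 1 :=
  ⟨isIntegral_one, by simp, by simp, by simp⟩

lemma mul (hx : IsSalemUnit ι τ x) (hy : IsSalemUnit ι τ y) : IsSalemUnit ι τ (x * y) where
  isIntegral := hx.isIntegral.mul hy.isIntegral
  mul_eq_one := by
    rw [map_mul, map_mul, mul_mul_mul_comm, hx.mul_eq_one, hy.mul_eq_one, one_mul]
  pos := by
    rw [map_mul]
    exact mul_pos hx.pos hy.pos
  norm_eq_one φ h1 h2 := by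
    rw [map_mul, norm_mul, hx.norm_eq_one φ h1 h2, hy.norm_eq_one φ h1 h2, one_mul]

lemma pow (hx : IsSalemUnit ι τ x) (n : ℕ) : IsSalemUnit ι τ (x ^ n) := by
  induction n with
  | zero => simpa using one ι τ
  | succ n ih =>
    rw [pow_succ]
    exact ih.mul hx

lemma inv (hx : IsSalemUnit ι τ x) : IsSalemUnit ι τ x⁻¹ where
  isIntegral := by
    -- `ι x⁻¹ = τ x` is integral because `x` is.
    refine (isIntegral_algHom_iff (ι.toIntAlgHom) ι.injective).1 ?_
    change IsIntegral ℤ (ι x⁻¹)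
    rw [map_inv₀, ← hx.map_eq_inv]
    exact hx.isIntegral.map τ.toIntAlgHom
  mul_eq_one := by
    rw [map_inv₀, map_inv₀, ← mul_inv, hx.mul_eq_one, inv_one]
  pos := by
    rw [map_inv₀]
    exact inv_pos.2 hx.pos
  norm_eq_one φ h1 h2 := by
    rw [map_inv₀, norm_inv, hx.norm_eq_one φ h1 h2, inv_one]

lemma exists_eq_mul_pow (hb : IsSalemUnit ι τ b) (hb1 : 1 < ι b) (hx : IsSalemUnit ι τ x)
    (hx1 : 1 ≤ ι x) :
    ∃ (m : ℕ) (u : K), IsSalemUnit ι τ u ∧ 1 ≤ ι u ∧ ι u < ι b ∧ x = u * b ^ m := by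
  obtain ⟨m, hm1, hm2⟩ := exists_nat_pow_near hx1 hb1
  have hpos : 0 < ι b ^ m := pow_pos hb.ι_pos m
  refine ⟨m, x * (b ^ m)⁻¹, hx.mul (hb.pow m).inv, ?_, ?_, ?_⟩
  · rw [map_mul, map_inv₀, map_pow, ← div_eq_mul_inv]
    exact (one_le_div hpos).2 hm1
  · rw [map_mul, map_inv₀, map_pow, ← div_eq_mul_inv, div_lt_iff₀ hpos, ← pow_succ']
    exact hm2
  · rw [inv_mul_cancel_right₀ (pow_ne_zero _ hb.ne_zero)]

variable [NumberField K]

lemma finite_setOf_lt (ι τ : K →+* ℝ) (C : ℝ) :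
    {u : K | IsSalemUnit ι τ u ∧ 1 ≤ ι u ∧ ι u < C}.Finite := by
  refine (NumberField.Embeddings.finite_of_norm_le K ℂ (max C 1)).subset ?_
  rintro u ⟨hu, hu1, hu2⟩
  refine ⟨hu.isIntegral, fun φ => ?_⟩
  by_cases h1 : φ = Complex.ofRealHom.comp ι
  · subst h1
    simp [abs_of_pos hu.ι_pos, hu2.le]
  by_cases h2 : φ = Complex.ofRealHom.comp τ
  · subst h2
    simp only [RingHom.comp_apply, Complex.ofRealHom_eq_coe, Complex.norm_real, Real.norm_eq_abs,
      abs_of_pos hu.pos]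
    rw [hu.map_eq_inv]
    exact (inv_le_one_of_one_le₀ hu1).trans (le_max_right _ _)
  · rw [hu.norm_eq_one φ h1 h2]
    exact le_max_right _ _

lemma exists_pow_eq_pow (hb : IsSalemUnit ι τ b) (hb1 : 1 < ι b) (hx : IsSalemUnit ι τ x)
    (hx1 : 1 ≤ ι x) : ∃ k, 0 < k ∧ ∃ l, x ^ k = b ^ l := by
  have h (i : ℕ) := exists_eq_mul_pow hb hb1 (hx.pow i) (by rw [map_pow]; exact one_le_pow₀ hx1)
  choose m f hf hf1 hf2 hxf using h
  have := (finite_setOf_lt ι τ (ι b)).to_subtype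
  obtain ⟨i, j, hij, hfij⟩ := Finite.exists_ne_map_eq_of_infinite
    (fun i => (⟨f i, hf i, hf1 i, hf2 i⟩ : {u : K | IsSalemUnit ι τ u ∧ 1 ≤ ι u ∧ ι u < ι b}))
  replace hfij : f i = f j := congrArg Subtype.val hfij
  wlog hlt : i < j generalizing i j
  · exact this j i hij.symm hfij.symm (by omega)
  have hpow : x ^ (j - i) * b ^ m i = b ^ m j := by
    have h1 : x ^ i * (x ^ (j - i) * b ^ m i) = x ^ i * b ^ m j := by
      rw [← mul_assoc, ← pow_add, Nat.add_sub_cancel' hlt.le, hxf j, hxf i, hfij]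
      ring
    exact mul_left_cancel₀ (pow_ne_zero _ hx.ne_zero) h1
  have hm : m i ≤ m j := by
    rw [← pow_le_pow_iff_right₀ hb1, ← map_pow, ← map_pow, ← hpow, map_mul, map_pow, map_pow]
    exact le_mul_of_one_le_left (pow_pos hb.ι_pos _).le (one_le_pow₀ hx1)
  refine ⟨j - i, by omega, m j - m i, ?_⟩
  refine mul_right_cancel₀ (pow_ne_zero (m i) hb.ne_zero) ?_
  rw [hpow, ← pow_add, Nat.sub_add_cancel hm]

/-- One exponent serves all units between `1` and `b`, since there are only finitely many. -/
lemma exists_uniform_pow_eq_pow (hb : IsSalemUnit ι τ b) (hb1 : 1 < ι b) :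
    ∃ k, 0 < k ∧ ∀ u, IsSalemUnit ι τ u → 1 ≤ ι u → ι u < ι b → ∃ l, u ^ k = b ^ l := by
  have h (u : {u : K | IsSalemUnit ι τ u ∧ 1 ≤ ι u ∧ ι u < ι b}) :=
    exists_pow_eq_pow hb hb1 u.2.1 u.2.2.1
  choose k hk l hl using h
  have := (finite_setOf_lt ι τ (ι b)).fintype
  refine ⟨∏ u, k u, Finset.prod_pos fun u _ => hk u, fun u h1 h2 h3 => ?_⟩
  obtain ⟨c, hc⟩ := Finset.dvd_prod_of_mem k (Finset.mem_univ ⟨u, h1, h2, h3⟩)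
  exact ⟨l ⟨u, h1, h2, h3⟩ * c, by rw [hc, pow_mul, pow_mul, ← hl ⟨u, h1, h2, h3⟩]⟩

/-- Among the units `x` with `ι x ≥ 1`, the powers of `b` are singled out by a congruence
condition: with `u ^ k` a power of `b` for all units `u` between `1` and `b`, and `w = b ^ M`
congruent to `1` modulo `k`, the modulus `w ^ k - 1 = b ^ (k * M) - 1` works. -/
theorem exists_forall_eq_pow_iff (hb : IsSalemUnit ι τ b) (hb1 : 1 < ι b) :
    ∃ (N : ℕ) (c : K), ∀ x, (∃ i, x = b ^ i) ↔
      IsSalemUnit ι τ x ∧ τ x ≤ 1 ∧ ∃ j ∈ Finset.range N, IsIntegral ℤ ((x - b ^ j) * c) := by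
  obtain ⟨k, hk, hpow⟩ := exists_uniform_pow_eq_pow hb hb1
  let v : 𝓞 K := ⟨b, hb.isIntegral⟩
  have hv : IsUnit v := IsUnit.of_mul_eq_one ⟨b⁻¹, hb.inv.isIntegral⟩
    (by ext; exact mul_inv_cancel₀ hb.ne_zero)
  obtain ⟨M, hM, hMk⟩ := exists_natCast_dvd_pow_sub_one hv hk.ne'
  have hne {n : ℕ} (hn : 0 < n) : b ^ n ≠ 1 := fun h => by
    have := congrArg ι h
    rw [map_pow, map_one] at this
    exact (one_lt_pow₀ hb1 hn.ne').ne' this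
  have hN : 0 < M * k := Nat.mul_pos hM hk
  have hN0 : b ^ (M * k) - 1 ≠ 0 := sub_ne_zero.2 (hne hN)
  refine ⟨M * k, (b ^ (M * k) - 1)⁻¹, fun x => ⟨?_, ?_⟩⟩
  · rintro ⟨i, rfl⟩
    refine ⟨hb.pow i, ?_, i % (M * k), Finset.mem_range.2 (Nat.mod_lt _ hN), ?_⟩
    · rw [map_pow, hb.map_eq_inv]
      exact pow_le_one₀ (inv_pos.2 hb.ι_pos).le (inv_le_one_of_one_le₀ hb1.le)
    · have h1 : b ^ i = b ^ (i % (M * k)) * (b ^ (M * k)) ^ (i / (M * k)) := by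
        rw [← pow_mul, ← pow_add, Nat.mod_add_div]
      have h2 : (b ^ i - b ^ (i % (M * k))) * (b ^ (M * k) - 1)⁻¹ =
          b ^ (i % (M * k)) * ∑ s ∈ Finset.range (i / (M * k)), (b ^ (M * k)) ^ s := by
        rw [← div_eq_mul_inv, div_eq_iff hN0, mul_assoc, geom_sum_mul, mul_sub, ← h1, mul_one]
      rw [h2]
      exact (hb.isIntegral.pow _).mul
        (IsIntegral.sum _ fun s _ => (hb.isIntegral.pow _).pow _)
  · rintro ⟨hx, hx1, j, -, hj⟩
    have hxι : 1 ≤ ι x := by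
      rw [← hx.mul_eq_one]
      exact mul_le_of_le_one_right hx.ι_pos.le hx1
    obtain ⟨m, u, hu, hu1, hub, rfl⟩ := exists_eq_mul_pow hb hb1 hx hxι
    obtain ⟨l, hl⟩ := hpow u hu hu1 hub
    suffices l = 0 by
      refine ⟨m, ?_⟩
      have h1 : ι u ^ k = 1 := by rw [← map_pow, hl, this, pow_zero, map_one]
      have h2 : ι u = ι 1 := by
        rw [map_one]
        exact (pow_eq_one_iff_of_nonneg hu.ι_pos.le hk.ne').1 h1
      rw [ι.injective h2, one_mul]
    have hlk : l < k := by
      rw [← pow_lt_pow_iff_right₀ hb1, ← map_pow, ← hl, map_pow]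
      exact pow_lt_pow_left₀ hub hu.ι_pos.le hk.ne'
    let y : 𝓞 K := ⟨u * b ^ m, hx.isIntegral⟩
    have hdvd : v ^ (M * k) - 1 ∣ y - v ^ j := by
      refine ⟨⟨_, hj⟩, ?_⟩
      ext
      change u * b ^ m - b ^ j = (b ^ (M * k) - 1) *
        ((u * b ^ m - b ^ j) * (b ^ (M * k) - 1)⁻¹)
      rw [mul_comm (_ - 1), inv_mul_cancel_right₀ hN0]
    have hyk : y ^ (M * k) = (v ^ M) ^ l * (v ^ (M * k)) ^ m := by
      ext
      change (u * b ^ m) ^ (M * k) = (b ^ M) ^ l * (b ^ (M * k)) ^ m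
      rw [mul_pow, mul_comm M k, pow_mul u, hl]
      ring
    have h1 : v ^ (M * k) - 1 ∣ (v ^ M) ^ l * (v ^ (M * k)) ^ m - (v ^ (M * k)) ^ j := by
      rw [← hyk, ← pow_mul _ _ j, mul_comm _ j, pow_mul _ j]
      exact hdvd.trans (sub_dvd_pow_sub_pow _ _ _)
    have h2 (n : ℕ) : v ^ (M * k) - 1 ∣ (v ^ (M * k)) ^ n - 1 := by
      simpa using sub_dvd_pow_sub_pow (v ^ (M * k)) 1 n
    -- Modulo `w ^ k - 1 = v ^ (M * k) - 1` the powers of `v ^ (M * k)` are `1`, and what is left of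
    -- the congruence `h1` is `w ^ l ≡ 1`.
    have h3 : (v ^ M) ^ k - 1 ∣ (v ^ M) ^ l - 1 := by
      rw [← pow_mul]
      have := dvd_sub (dvd_add h1 (h2 j)) ((h2 m).mul_left ((v ^ M) ^ l))
      convert this using 1
      ring
    have hw : v ^ M ≠ 1 := fun h => hne hM (congrArg (algebraMap (𝓞 K) K) h)
    have h4 := dvd_of_natCast_dvd_ringOfIntegers hk.ne'
      (natCast_dvd_natCast_of_pow_sub_one_dvd hw hMk h3)
    exact Nat.eq_zero_of_dvd_of_lt h4 hlk

end IsSalemUnit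

/-! ### Values of linear functionals on powers, and linear recurrences -/

section RangeOfLinearFunctional

variable {K : Type*} [Field K] [NumberField K] {L : Type*} [Field L] [NumberField L]
  {ι τ : K →+* ℝ} {b : K}

namespace IsGenPolyFieldMap

variable {X : L → K}

lemma comp_ringHom (hX : IsGenPolyFieldMap X) (ι : K →+* ℝ) :
    IsRealGenPolyMap (fun q => ι (X q)) :=
  hX ι.toRatAlgHom.toLinearMap

lemma isRealGenPolySet_norm_eq_one (hX : IsGenPolyFieldMap X) (φ : K →+* ℂ) :
    IsRealGenPolySet {q | ‖φ (X q)‖ = 1} := by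
  have hre := hX ((Complex.reLm.restrictScalars ℚ).comp φ.toRatAlgHom.toLinearMap)
  have him := hX ((Complex.imLm.restrictScalars ℚ).comp φ.toRatAlgHom.toLinearMap)
  have := ((hre.mul hre).add (him.mul him)).isRealGenPolySet_eq (.const 1)
  convert this using 1
  ext q
  simp only [Set.mem_ofPred_eq]
  rw [← sq_eq_sq₀ (norm_nonneg _) zero_le_one, Complex.sq_norm, Complex.normSq_apply, one_pow]
  rfl

lemma isRealGenPolySet_isSalemUnit (hX : IsGenPolyFieldMap X) (ι τ : K →+* ℝ) :
    IsRealGenPolySet {q | IsSalemUnit ι τ (X q) ∧ τ (X q) ≤ 1} := by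
  classical
  have h1 := hX.isRealGenPolySet_isIntegral
  have h2 := ((hX.comp_ringHom ι).mul (hX.comp_ringHom τ)).isRealGenPolySet_eq (.const 1)
  -- As `τ x ≠ 0` by the previous condition, `⌊1 - τ x⌋ = 0` expresses `0 < τ x ≤ 1`.
  have h3 := ((IsRealGenPolyMap.const 1).sub (hX.comp_ringHom τ)).floor.isRealGenPolySet_eq_zero
  have h4 := IsRealGenPolySet.forall_mem (Finset.univ.filter fun φ : K →+* ℂ =>
    φ ≠ Complex.ofRealHom.comp ι ∧ φ ≠ Complex.ofRealHom.comp τ)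
    fun φ _ => hX.isRealGenPolySet_norm_eq_one φ
  convert (h1.inter h2).inter (h3.inter h4) using 1
  ext q
  simp only [Set.mem_ofPred_eq, Set.mem_inter_iff, Finset.mem_filter, Finset.mem_univ, true_and,
    Int.cast_eq_zero, Int.floor_eq_zero_iff, Set.mem_Ico]
  constructor
  · rintro ⟨h, hle⟩
    exact ⟨⟨h.isIntegral, h.mul_eq_one⟩, ⟨by linarith, by linarith [h.pos]⟩,
      fun φ hφ => h.norm_eq_one φ hφ.1 hφ.2⟩
  · rintro ⟨⟨h1, h2⟩, ⟨h3, h3'⟩, h4⟩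
    exact ⟨⟨h1, h2, by linarith, fun φ hφ hφ' => h4 φ ⟨hφ, hφ'⟩⟩, by linarith⟩

lemma isRealGenPolySet_exists_eq_pow (hX : IsGenPolyFieldMap X) (hb : IsSalemUnit ι τ b)
    (hb1 : 1 < ι b) : IsRealGenPolySet {q | ∃ i, X q = b ^ i} := by
  obtain ⟨N, c, h⟩ := hb.exists_forall_eq_pow_iff hb1
  have := (hX.isRealGenPolySet_isSalemUnit ι τ).inter
    (IsRealGenPolySet.exists_mem (Finset.range N)
      fun j _ => (hX.sub_mul_const (b ^ j) c).isRealGenPolySet_isIntegral)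
  convert this using 1
  ext q
  simp only [Set.mem_ofPred_eq, Set.mem_inter_iff, h, and_assoc]

end IsGenPolyFieldMap

lemma exists_forall_eq_trace_mul (l : K →ₗ[ℚ] ℚ) :
    ∃ c : K, ∀ x, l x = Algebra.trace ℚ K (c * x) := by
  refine ⟨((Algebra.traceForm ℚ K).toDual (traceForm_nondegenerate ℚ K)).symm l, fun x => ?_⟩
  rw [← Algebra.traceForm_apply, LinearMap.BilinForm.apply_toDual_symm_apply]

/-- All embeddings other than `ι` map `b` into the closed unit disc, hence contribute a bounded
amount to the trace. -/
lemma IsSalemUnit.exists_abs_trace_mul_pow_sub_le (hb : IsSalemUnit ι τ b) (hb1 : 1 < ι b)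
    (c : K) : ∃ B : ℝ, ∀ i : ℕ, |(Algebra.trace ℚ K (c * b ^ i) : ℝ) - ι c * ι b ^ i| ≤ B := by
  classical
  let σ₀ : K →ₐ[ℚ] ℂ := (Complex.ofRealHom.comp ι).toRatAlgHom
  refine ⟨∑ σ : K →ₐ[ℚ] ℂ, ‖σ c‖, fun i => ?_⟩
  have h1 := trace_eq_sum_embeddings (K := ℚ) (L := K) ℂ (x := c * b ^ i)
  have h2 : ((Algebra.trace ℚ K (c * b ^ i) : ℝ) : ℂ) - ((ι c * ι b ^ i : ℝ) : ℂ) =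
      ∑ σ ∈ Finset.univ.erase σ₀, σ (c * b ^ i) := by
    rw [Finset.sum_erase_eq_sub (Finset.mem_univ _), ← h1]
    simp [σ₀]
  rw [← Real.norm_eq_abs, ← Complex.norm_real, Complex.ofReal_sub, h2]
  refine (norm_sum_le _ _).trans ((Finset.sum_le_sum fun σ hσ => ?_).trans
    (Finset.sum_le_sum_of_subset_of_nonneg (Finset.erase_subset σ₀ _)
      fun _ _ _ => norm_nonneg _))
  rw [map_mul, map_pow, norm_mul, norm_pow]
  refine mul_le_of_le_one_right (norm_nonneg _) (pow_le_one₀ (norm_nonneg _) ?_)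
  have hne : (σ : K →+* ℂ) ≠ Complex.ofRealHom.comp ι := fun h =>
    Finset.ne_of_mem_erase hσ (by ext x; exact congrArg (fun f : K →+* ℂ => f x) h)
  by_cases hτ : (σ : K →+* ℂ) = Complex.ofRealHom.comp τ
  · have : σ b = (τ b : ℂ) := congrArg (fun f : K →+* ℂ => f b) hτ
    rw [this, Complex.norm_real, Real.norm_eq_abs, abs_of_pos hb.pos, hb.map_eq_inv]
    exact inv_le_one_of_one_le₀ hb1.le
  · exact (hb.norm_eq_one _ hne hτ).le

/-- The value `q = μ (b ^ i)` determines `b ^ i` up to finitely many possibilities: it is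
asymptotically proportional to `b ^ i`, and so are the coordinates of `b ^ i` in an integral basis.
These coordinates are integers, so each of them is `⌊κ * q⌋ + e` for some real `κ` that does not
depend on `i` and some integer `e` from a finite set. -/
theorem IsSalemUnit.isRealGenPolySet_range (hb : IsSalemUnit ι τ b) (hb1 : 1 < ι b)
    (μ : K →ₗ[ℚ] ℚ) : IsRealGenPolySet (Set.range fun i : ℕ => μ (b ^ i)) := by
  classical
  have hid : IsRealGenPolyMap (fun q : ℚ => (q : ℝ)) :=
    .linear (Rat.castHom ℝ).toRatAlgHom.toLinearMap
  obtain ⟨c₀, hc₀⟩ := exists_forall_eq_trace_mul μ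
  rcases eq_or_ne c₀ 0 with rfl | hc
  · convert hid.isRealGenPolySet_eq_zero using 1
    ext q
    simp [hc₀, eq_comm (a := q)]
  let ω := NumberField.integralBasis K
  choose c hcoord using fun s => exists_forall_eq_trace_mul (ω.coord s)
  choose B hB using hb.exists_abs_trace_mul_pow_sub_le hb1
  have hιc : ι c₀ ≠ 0 := (map_ne_zero ι).2 hc
  let κ s := ι (c s) / ι c₀
  -- The extra `1` accounts for the error of the floor function.
  let T s : ℤ := ⌈B (c s) + |κ s| * B c₀⌉ + 1
  let X (e : _ → ℤ) (q : ℚ) : K := ∑ s, ((⌊κ s * q⌋ + e s : ℤ) : ℚ) • ω s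
  have hX e : IsGenPolyFieldMap (X e) := fun l => by
    have := IsRealGenPolyMap.sum Finset.univ fun s _ =>
      (((IsRealGenPolyMap.const (κ s)).mul hid).floor.add (.const (e s : ℝ))).mul (.const (l (ω s)))
    convert this using 2 with q
    simp only [X, map_sum, map_smul]
    refine Finset.sum_congr rfl fun s _ => ?_
    rw [Rat.smul_def]
    push_cast
    rfl
  have key := IsRealGenPolySet.exists_mem (Fintype.piFinset fun s => Finset.Icc (-T s) (T s))
    (p := fun e q => (∃ i, X e q = b ^ i) ∧ Algebra.linearMap ℚ ℝ (μ (X e q)) = q)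
    fun e _ => by
      rw [Set.ofPred_and]
      exact ((hX e).isRealGenPolySet_exists_eq_pow hb hb1).inter
        ((hX e ((Algebra.linearMap ℚ ℝ).comp μ)).isRealGenPolySet_eq hid)
  convert key using 1
  ext q
  simp only [Set.mem_range, Set.mem_ofPred_eq, Algebra.linearMap_apply, eq_ratCast, Rat.cast_inj]
  constructor
  · rintro ⟨i, rfl⟩
    choose z hz using isIntegral_iff_forall_repr_integralBasis.1 (hb.pow i).isIntegral
    have hXe : X (fun s => z s - ⌊κ s * μ (b ^ i)⌋) (μ (b ^ i)) = b ^ i := by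
      simp only [X, add_sub_cancel, hz]
      exact ω.sum_repr (b ^ i)
    refine ⟨fun s => z s - ⌊κ s * μ (b ^ i)⌋, ?_, ⟨i, hXe⟩, by rw [hXe]⟩
    rw [Fintype.mem_piFinset]
    intro s
    have h1 := hB (c s) i
    have h2 := hB c₀ i
    rw [← hcoord] at h1
    rw [← hc₀] at h2
    have h3 : ((ω.coord s (b ^ i) : ℚ) : ℝ) = z s := by
      rw [Module.Basis.coord_apply, ← hz, Rat.cast_intCast]
    rw [h3] at h1
    have h4 : |(z s : ℝ) - κ s * μ (b ^ i)| ≤ B (c s) + |κ s| * B c₀ := by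
      have h5 : (z s : ℝ) - κ s * μ (b ^ i) =
          (z s - ι (c s) * ι b ^ i) - κ s * (μ (b ^ i) - ι c₀ * ι b ^ i) := by
        simp only [κ]
        field_simp
        ring
      rw [h5]
      refine (abs_sub _ _).trans (add_le_add h1 ?_)
      rw [abs_mul]
      exact mul_le_mul_of_nonneg_left h2 (abs_nonneg _)
    obtain ⟨h6, h7⟩ := abs_le.1 (h4.trans (Int.le_ceil _))
    have h8 := Int.floor_le (κ s * μ (b ^ i))
    have h9 := Int.lt_floor_add_one (κ s * μ (b ^ i))
    rw [Finset.mem_Icc]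
    constructor
    · have : ((-T s : ℤ) : ℝ) ≤ ((z s - ⌊κ s * μ (b ^ i)⌋ : ℤ) : ℝ) := by
        push_cast [T]
        linarith
      exact_mod_cast this
    · have : ((z s - ⌊κ s * μ (b ^ i)⌋ : ℤ) : ℝ) ≤ ((T s : ℤ) : ℝ) := by
        push_cast [T]
        linarith
      exact_mod_cast this
  · rintro ⟨e, -, ⟨i, hi⟩, hq⟩
    exact ⟨i, by rw [← hi, hq]⟩

end RangeOfLinearFunctional

section LinearRecurrence

lemma exists_linearMap_pow_eq {A : Type*} [CommRing A] [Algebra ℚ A] (pb : PowerBasis ℚ A)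
    (E : LinearRecurrence ℚ) (hE : E.charPoly = minpoly ℚ pb.gen) {n : ℕ → ℚ}
    (hn : E.IsSolution n) : ∃ μ : A →ₗ[ℚ] ℚ, ∀ i, μ (pb.gen ^ i) = n i := by
  have hdim : E.order = pb.dim := by
    rw [← pb.natDegree_minpoly, ← hE,
      Polynomial.natDegree_eq_of_degree_eq_some E.charPoly_degree_eq_order]
  let μ := pb.basis.constr ℚ (fun j => n j)
  have hroot : pb.gen ^ E.order = ∑ j, E.coeffs j • pb.gen ^ (j : ℕ) := by
    have h := minpoly.aeval ℚ pb.gen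
    rw [← hE, LinearRecurrence.charPoly] at h
    simpa [Polynomial.aeval_monomial, sub_eq_zero, Algebra.smul_def] using h
  have hμ : E.IsSolution fun i => μ (pb.gen ^ i) := fun i => by
    simp only [pow_add, hroot, Finset.mul_sum, map_sum, mul_smul_comm, map_smul, smul_eq_mul]
  refine ⟨μ, fun i => ?_⟩
  refine congrFun ((E.eq_iff_eqOn_range_order _ _ hμ hn).2 fun j hj => ?_) i
  have hj' : j < pb.dim := by simpa [hdim] using hj
  have := pb.basis.constr_basis ℚ (fun j => n j) ⟨j, hj'⟩
  rwa [pb.coe_basis] at this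

end LinearRecurrence

/-! ### Conjugates of Salem numbers -/

section SalemNumber

open IntermediateField Polynomial

/-- The minimal polynomial of a Salem number has a root `α` with `α⁻¹ = conj α`, also a root; by
transport along `β ↦ α` the inverse of `β` is a root. -/
lemma IsSalem.aeval_inv_eq_zero {β : ℝ} (hβ : IsSalem β) : aeval β⁻¹ (minpoly ℚ β) = 0 := by
  obtain ⟨hint, -, -, α, hα, hα1⟩ := hβ
  have hintQ : IsIntegral ℚ β := hint.tower_top
  let ψ : ℚ⟮β⟯ →ₐ[ℚ] ℂ := (algHomAdjoinIntegralEquiv ℚ hintQ).symm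
    ⟨α, by rw [mem_aroots]; exact ⟨minpoly.ne_zero hintQ, hα⟩⟩
  have hψ : ψ (AdjoinSimple.gen ℚ β) = α := algHomAdjoinIntegralEquiv_symm_apply_gen ℚ hintQ _
  have h1 : aeval (AdjoinSimple.gen ℚ β)⁻¹ (minpoly ℚ β) = 0 := by
    apply (ψ : ℚ⟮β⟯ →+* ℂ).injective
    change ψ _ = ψ 0
    rw [← aeval_algHom_apply, map_inv₀, hψ, map_zero, Complex.inv_eq_conj hα1]
    have h2 : ((starRingEnd ℂ).toRatAlgHom) α = starRingEnd ℂ α := rfl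
    rw [← h2, aeval_algHom_apply]
    have h3 : aeval α (minpoly ℚ β) = 0 := hα
    rw [h3, map_zero]
  have h4 := congrArg (algebraMap ℚ⟮β⟯ ℝ) h1
  rwa [← aeval_algebraMap_apply, map_zero, map_inv₀, AdjoinSimple.algebraMap_gen] at h4

lemma IsSalem.exists_isSalemUnit_gen {β : ℝ} (hβ : IsSalem β) [NumberField ℚ⟮β⟯] :
    ∃ τ : ℚ⟮β⟯ →+* ℝ, IsSalemUnit (algebraMap ℚ⟮β⟯ ℝ) τ (AdjoinSimple.gen ℚ β) := by
  have hinv := hβ.aeval_inv_eq_zero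
  obtain ⟨hint, hβ1, hle, -⟩ := hβ
  have hintQ : IsIntegral ℚ β := hint.tower_top
  have hβ0 : 0 < β := one_pos.trans hβ1
  let τ : ℚ⟮β⟯ →ₐ[ℚ] ℝ := (algHomAdjoinIntegralEquiv ℚ hintQ).symm
    ⟨β⁻¹, by rw [mem_aroots]; exact ⟨minpoly.ne_zero hintQ, hinv⟩⟩
  have hτ : τ (AdjoinSimple.gen ℚ β) = β⁻¹ := algHomAdjoinIntegralEquiv_symm_apply_gen ℚ hintQ _
  have hι : algebraMap ℚ⟮β⟯ ℝ (AdjoinSimple.gen ℚ β) = β := AdjoinSimple.algebraMap_gen ℚ β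
  have hext (φ φ' : ℚ⟮β⟯ →+* ℂ)
      (h : φ (AdjoinSimple.gen ℚ β) = φ' (AdjoinSimple.gen ℚ β)) : φ = φ' := by
    have : φ.toRatAlgHom = φ'.toRatAlgHom :=
      (adjoin.powerBasis hintQ).algHom_ext (by rw [adjoin.powerBasis_gen]; exact h)
    ext x
    exact congrArg (fun f : ℚ⟮β⟯ →ₐ[ℚ] ℂ => f x) this
  refine ⟨τ, ⟨?_, ?_, ?_, fun φ h1 h2 => ?_⟩⟩
  · rw [← isIntegral_algebraMap_iff (B := ℝ) (algebraMap ℚ⟮β⟯ ℝ).injective, hι]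
    exact hint
  · change _ * τ _ = 1
    rw [hι, hτ, mul_inv_cancel₀ hβ0.ne']
  · change 0 < τ _
    rw [hτ]
    exact inv_pos.2 hβ0
  · have hφβ : IsConjugate (φ (AdjoinSimple.gen ℚ β)) β := by
      have h3 : aeval (AdjoinSimple.gen ℚ β) (minpoly ℚ β) = 0 := by
        rw [← minpoly_gen ℚ β]
        exact minpoly.aeval _ _
      have h4 := aeval_algHom_apply φ.toRatAlgHom (AdjoinSimple.gen ℚ β) (minpoly ℚ β)
      rw [h3, map_zero] at h4
      exact h4
    have hφinv : IsConjugate (φ (AdjoinSimple.gen ℚ β)⁻¹) β := by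
      have h3 : aeval (AdjoinSimple.gen ℚ β)⁻¹ (minpoly ℚ β) = 0 := by
        apply (algebraMap ℚ⟮β⟯ ℝ).injective
        rw [← aeval_algebraMap_apply, map_inv₀, hι, hinv, map_zero]
      have h4 := aeval_algHom_apply φ.toRatAlgHom (AdjoinSimple.gen ℚ β)⁻¹ (minpoly ℚ β)
      rw [h3, map_zero] at h4
      exact h4
    have hφ0 : φ (AdjoinSimple.gen ℚ β) ≠ 0 := by
      rw [_root_.map_ne_zero]
      intro h
      rw [h, map_zero] at hι
      exact hβ0.ne hι
    have h5 : ‖φ (AdjoinSimple.gen ℚ β)‖ ≤ 1 := hle _ hφβ fun h => h1 (hext _ _ (by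
      rw [h, RingHom.comp_apply, hι]; rfl))
    have h6 : ‖φ (AdjoinSimple.gen ℚ β)⁻¹‖ ≤ 1 := hle _ hφinv fun h => h2 (hext _ _ (by
      rw [map_inv₀, inv_eq_iff_eq_inv] at h
      change _ = ((τ (AdjoinSimple.gen ℚ β) : ℝ) : ℂ)
      rw [h, hτ, Complex.ofReal_inv]))
    rw [map_inv₀, norm_inv, inv_le_one₀ (norm_pos_iff.2 hφ0)] at h6
    exact le_antisymm h5 h6

end SalemNumber

end GenPoly

open IntermediateField in
theorem theoremA (β : ℝ) (hβ : GenPoly.IsSalem β)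
    (E : LinearRecurrence ℚ) (hE : E.charPoly = minpoly ℚ β)
    (n : ℕ → ℚ) (hn : E.IsSolution n) :
    GenPoly.IsGenPolySet (Set.range n) := by
  have hint : IsIntegral ℚ β := hβ.1.tower_top
  have := adjoin.finiteDimensional hint
  have : NumberField ℚ⟮β⟯ := ⟨⟩
  obtain ⟨τ, hb⟩ := hβ.exists_isSalemUnit_gen
  obtain ⟨μ, hμ⟩ := GenPoly.exists_linearMap_pow_eq (adjoin.powerBasis hint) E
    (by rw [hE, adjoin.powerBasis_gen, minpoly_gen]) hn
  have hb1 : 1 < algebraMap ℚ⟮β⟯ ℝ (AdjoinSimple.gen ℚ β) := by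
    rw [AdjoinSimple.algebraMap_gen]
    exact hβ.2.1
  convert (hb.isRealGenPolySet_range hb1 μ).isGenPolySet using 1
  congr 1
  funext i
  rw [← hμ i, adjoin.powerBasis_gen]
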